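/- Setting. Let $\Theta$ be a parameter space with a $\sigma$-finite reference measure (for instance a Borel set $\Theta\subseteq\mathbb R^{p}$ with Lebesgue measure), let $\eta$ be a prior density on $\Theta$, and let the likelihood be of exponential family form $p(y\mid\theta)=h(y)\,g(\theta)\exp[\varphi(\theta)^{T}S(y)]$, $y\in\mathcal Y$, with $h\ge0$, $g>0$ and $\varphi(\theta),S(y)\in\mathbb R^{d}$. Put $S_n(y_{1:n})=\sum_{i=1}^nS(y_i)$, and assume that $\nabla_2S=\sup_{x,y\in\mathcal Y}\|S(x)-S(y)\|_2$ is finite. For each $n$ let $q_n(\theta'\mid\theta)$ be a proposal density that does not depend on the data. Algorithm. Fix $\xi_n\ge0$ and start at $\theta_{n,0}=\theta_0$. Iteration $t$, from $\theta=\theta_{n,t-1}$, draws a proposal $\theta'=\theta'_{n,t}\sim q_n(\cdot\mid\theta)$, releases a fresh independent noisy statistic $\hat S^{(t)}\sim\mathcal N(S_n(y_{1:n}),\xi_nI_d)$, and sets $\theta_{n,t}=\theta'$ with probability $$\min\Big\{1,\frac{\eta(\theta')q_n(\theta\mid\theta')}{\eta(\theta)q_n(\theta'\mid\theta)}\exp\big(\hat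 d_n(\theta,\theta')-\sigma_n^2(\theta,\theta')/2\big)\Big\}$$ and $\theta_{n,t}=\theta$ otherwise. Here $\hat d_n(\theta,\theta')=n[\log g(\theta')-\log g(\theta)]+[\varphi(\theta')-\varphi(\theta)]^{T}\hat S^{(t)}$ and $\sigma_n^2(\theta,\theta')=\|\varphi(\theta')-\varphi(\theta)\|_2^2\,\xi_n$; the acceptance probability is $1$ if $\eta(\theta)q_n(\theta'\mid\theta)=0$. The output of $k$ iterations is the view $\{\theta_{n,t},\theta'_{n,t},\hat S^{(t)}:1\le t\le k\}$. It is $(\epsilon,\delta)$-differentially private if, for all data sets $x,y\in\mathcal Y^n$ that differ in at most one entry and all measurable sets $A$ of views, $P_x(A)\le e^{\epsilon}P_y(A)+\delta$, where $P_y$ is the law of the view for the data set $y$. For $\sigma>0$ and given $c,\alpha>0$ take $$\xi_n=\sigma^2(\nabla_2S)^2n^{2\alpha}/c^2,$$ and let $P_{n,\sigma,\theta_0}$ be the joint law of $(\theta'_{n,t},\theta_{n,t})_{t\ge1}$ (it also depends on the data). Assumption. Let $c,\alpha>0$ and $\theta_0\in\Theta$ be such that for all $n\ge1$, all data sets and all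 $\sigma>0$, $P_{n,\sigma,\theta_0}$-a.s. $\|\varphi(\theta'_{n,t})-\varphi(\theta_{n,t-1})\|_2<c\,n^{-\alpha}$ for every $t\ge1$. Corollary. For every $\beta>0$ and $k_0>0$ there exists $\sigma^2>0$ such that the following hold. 1. For every $n\ge2$, the $k(n)=\lfloor k_0n^{2\alpha}/\log n\rfloor$ iterations of the algorithm with this $\xi_n$ are $(\epsilon_n,\delta_n)$-differentially private, where $$\epsilon_n=2\sqrt{k_0(2\alpha+\beta)\beta}\,\frac c\sigma+4k_0\frac{c^2}{\sigma^2}(2\alpha+\beta),\qquad\delta_n=1.25\,k_0\frac{n^{-\beta}}{\log n}+n^{-\beta}.$$ 2. The induced penalty variance is bounded: for all $n\ge1$, $\sigma_n^2(\theta,\theta')\le(\nabla_2S)^2\sigma^2$ for all $\theta,\theta'\in\Theta$ with $\|\varphi(\theta')-\varphi(\theta)\|_2<c\,n^{-\alpha}$. Consequently, for every data set, $P_{n,\sigma,\theta_0}$-a.s., $\sigma_n^2(\theta_{n,t-1},\theta'_{n,t})\le(\nabla_2S)^2\sigma^2$ for every $t\ge1$. -/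

import Mathlib

open MeasureTheory ProbabilityTheory
open scoped ENNReal

set_option linter.unusedSectionVars false

noncomputable section

namespace PenaltyDP

/-- `(ε, δ)`-differential privacy of a randomised algorithm `A`, given by the law `A x` of its
output on the data set `x`. Neighbouring data sets differ in at most one entry. -/
def IsDP {n : ℕ} {Y Ω : Type*} [MeasurableSpace Ω] (A : (Fin n → Y) → Measure Ω)
    (ε δ : ℝ) : Prop :=
  ∀ x y : Fin n → Y, (letI := Classical.decEq Y; hammingDist x y) ≤ 1 →
    ∀ s : Set Ω, MeasurableSet s →
      A x s ≤ ENNReal.ofReal (Real.exp ε) * A y s + ENNReal.ofReal δ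

/-- A Bayesian model with exponential family likelihood
`p(y | θ) = h(y) g(θ) exp(φ(θ)ᵀ S(y))`, a density with respect to `ν` on the sample space `Y`,
and with a prior density `η` with respect to `lam` on the parameter space `Θ`
(for a Borel set `Θ ⊆ ℝᵖ`, `lam` is Lebesgue measure on `Θ`). -/
structure ExpModel (Θ Y : Type*) [MeasurableSpace Θ] [MeasurableSpace Y]
    (lam : Measure Θ) (ν : Measure Y) (d : ℕ) where
  h : Y → ℝ
  g : Θ → ℝ
  φ : Θ → EuclideanSpace ℝ (Fin d)
  S : Y → EuclideanSpace ℝ (Fin d)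
  η : Θ → ℝ
  h_measurable : Measurable h
  g_measurable : Measurable g
  φ_measurable : Measurable φ
  S_measurable : Measurable S
  η_measurable : Measurable η
  h_nonneg : ∀ y, 0 ≤ h y
  g_pos : ∀ θ, 0 < g θ
  η_nonneg : ∀ θ, 0 ≤ η θ
  lintegral_likelihood : ∀ θ,
    ∫⁻ y, ENNReal.ofReal (h y * g θ * Real.exp (inner ℝ (φ θ) (S y))) ∂ν = 1
  lintegral_prior : ∫⁻ θ, ENNReal.ofReal (η θ) ∂lam = 1

/-- A proposal density; `dens θ θ'` is `q(θ' | θ)`. It does not depend on the data. -/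
structure Proposal (Θ : Type*) [MeasurableSpace Θ] (lam : Measure Θ) where
  dens : Θ → Θ → ℝ
  dens_measurable : Measurable (Function.uncurry dens)
  dens_nonneg : ∀ θ θ', 0 ≤ dens θ θ'
  lintegral_dens : ∀ θ, ∫⁻ θ', ENNReal.ofReal (dens θ θ') ∂lam = 1

section Kernels

variable {Θ : Type*} [MeasurableSpace Θ] {lam : Measure Θ} [SigmaFinite lam]

/-- The Markov kernel `θ ↦ q(· | θ)`. -/
def Proposal.kernel (q : Proposal Θ lam) : Kernel Θ Θ :=
  Kernel.withDensity (Kernel.const Θ lam) (fun θ θ' => ENNReal.ofReal (q.dens θ θ'))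

instance (q : Proposal Θ lam) : IsMarkovKernel q.kernel := by
  refine ⟨fun θ => ⟨?_⟩⟩
  have hm : Measurable (Function.uncurry fun θ θ' => ENNReal.ofReal (q.dens θ θ')) :=
    q.dens_measurable.ennreal_ofReal
  rw [Proposal.kernel, Kernel.withDensity_apply' _ hm]
  simpa using q.lintegral_dens θ

variable {Y : Type*} [MeasurableSpace Y] {ν : Measure Y} {d : ℕ}

namespace ExpModel

variable (M : ExpModel Θ Y lam ν d) (q : Proposal Θ lam)

/-- The `ℓ₂` sensitivity `∇₂ S = sup_{x, y} ‖S x - S y‖`. -/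
def sensitivity : ℝ := ⨆ p : Y × Y, ‖M.S p.1 - M.S p.2‖

/-- The sufficient statistic `S_n(y_{1:n}) = ∑ i, S(y_i)` of a data set. -/
def stat {n : ℕ} (y : Fin n → Y) : EuclideanSpace ℝ (Fin d) := ∑ i, M.S (y i)

/-- The log-likelihood ratio `n [log g(θ') - log g(θ)] + [φ(θ') - φ(θ)]ᵀ s`, as a function of the
(exact or noisy) value `s` of the sufficient statistic. -/
def logRatio (n : ℕ) (θ θ' : Θ) (s : EuclideanSpace ℝ (Fin d)) : ℝ :=
  n * (Real.log (M.g θ') - Real.log (M.g θ)) + inner ℝ (M.φ θ' - M.φ θ) s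

/-- The penalty variance `[φ(θ') - φ(θ)]ᵀ [φ(θ') - φ(θ)] ξ` induced by noise of variance `ξ` on
each coordinate of the sufficient statistic. -/
def penaltyVar (ξ : ℝ) (θ θ' : Θ) : ℝ :=
  inner ℝ (M.φ θ' - M.φ θ) (M.φ θ' - M.φ θ) * ξ

open Classical in
/-- The probability of accepting `θ'` at `θ` when the noisy statistic is `s`. Where the
denominator `η(θ) q(θ' | θ)` vanishes it is `1`, as usual for Metropolis-Hastings. -/
def acceptProb (n : ℕ) (ξ : ℝ) (θ θ' : Θ) (s : EuclideanSpace ℝ (Fin d)) : ℝ :=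
  if M.η θ * q.dens θ θ' = 0 then 1
  else min 1 ((M.η θ' * q.dens θ' θ) / (M.η θ * q.dens θ θ') *
    Real.exp (M.logRatio n θ θ' s - M.penaltyVar ξ θ θ' / 2))

lemma measurable_acceptProb (n : ℕ) (ξ : ℝ) :
    Measurable fun p : Θ × (Θ × EuclideanSpace ℝ (Fin d)) =>
      M.acceptProb q n ξ p.1 p.2.1 p.2.2 := by
  have hg := M.g_measurable
  have hφ := M.φ_measurable
  have hη := M.η_measurable
  have hq : Measurable fun p : Θ × (Θ × EuclideanSpace ℝ (Fin d)) => q.dens p.1 p.2.1 :=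
    q.dens_measurable.comp (measurable_fst.prodMk measurable_snd.fst)
  have hq' : Measurable fun p : Θ × (Θ × EuclideanSpace ℝ (Fin d)) => q.dens p.2.1 p.1 :=
    q.dens_measurable.comp (measurable_snd.fst.prodMk measurable_fst)
  unfold acceptProb logRatio penaltyVar
  refine Measurable.ite ?_ measurable_const ?_
  · exact measurableSet_eq_fun (by fun_prop) measurable_const
  · fun_prop

/-- The accept-reject decision: from the current `θ`, the proposed `θ'` and the noisy statistic
`s`, move to `θ'` with the acceptance probability and stay at `θ` otherwise. -/
def decision (n : ℕ) (ξ : ℝ) : Kernel (Θ × (Θ × EuclideanSpace ℝ (Fin d))) Θ where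
  toFun p :=
    ENNReal.ofReal (M.acceptProb q n ξ p.1 p.2.1 p.2.2) • Measure.dirac p.2.1 +
      ENNReal.ofReal (1 - M.acceptProb q n ξ p.1 p.2.1 p.2.2) • Measure.dirac p.1
  measurable' := by
    have ha := M.measurable_acceptProb q n ξ
    refine Measure.measurable_of_measurable_coe _ fun s hs => ?_
    simp only [Measure.add_apply, Measure.smul_apply, smul_eq_mul, Measure.dirac_apply' _ hs]
    have h1 : Measurable (s.indicator (1 : Θ → ℝ≥0∞)) := measurable_one.indicator hs
    exact (ha.ennreal_ofReal.mul (h1.comp measurable_snd.fst)).add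
      ((measurable_const.sub ha).ennreal_ofReal.mul (h1.comp measurable_fst))

lemma acceptProb_nonneg (n : ℕ) (ξ : ℝ) (θ θ' : Θ) (s : EuclideanSpace ℝ (Fin d)) :
    0 ≤ M.acceptProb q n ξ θ θ' s := by
  unfold acceptProb
  split_ifs
  · exact zero_le_one
  · exact le_min zero_le_one (mul_nonneg (div_nonneg (mul_nonneg (M.η_nonneg _) (q.dens_nonneg _ _))
      (mul_nonneg (M.η_nonneg _) (q.dens_nonneg _ _))) (Real.exp_pos _).le)

lemma acceptProb_le_one (n : ℕ) (ξ : ℝ) (θ θ' : Θ) (s : EuclideanSpace ℝ (Fin d)) :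
    M.acceptProb q n ξ θ θ' s ≤ 1 := by
  unfold acceptProb
  split_ifs
  · exact le_rfl
  · exact min_le_left _ _

instance (n : ℕ) (ξ : ℝ) : IsMarkovKernel (M.decision q n ξ) := by
  refine ⟨fun p => ⟨?_⟩⟩
  change (ENNReal.ofReal (M.acceptProb q n ξ p.1 p.2.1 p.2.2) • Measure.dirac p.2.1 +
      ENNReal.ofReal (1 - M.acceptProb q n ξ p.1 p.2.1 p.2.2) • Measure.dirac p.1) Set.univ = 1
  simp only [Measure.add_apply, Measure.smul_apply, smul_eq_mul, measure_univ, mul_one]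
  rw [← ENNReal.ofReal_add (M.acceptProb_nonneg ..) (sub_nonneg.2 (M.acceptProb_le_one ..))]
  simp

/-- What one iteration reveals: `((θ', ŝ), θ)` consists of the proposal `θ'`, the noisy sufficient
statistic `ŝ` and the new state `θ`. -/
abbrev Iteration (Θ : Type*) (d : ℕ) : Type _ := (Θ × EuclideanSpace ℝ (Fin d)) × Θ

/-- One iteration of the algorithm from the current state: propose `θ' ∼ q(· | θ)`,
independently release `ŝ ∼ N(S_n(y), ξ I)`, then accept or reject. -/
def step {n : ℕ} (ξ : ℝ) (y : Fin n → Y) : Kernel Θ (Iteration Θ d) :=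
  (q.kernel ×ₖ Kernel.const Θ (multivariateGaussian (M.stat y) (ξ • 1))) ⊗ₖ M.decision q n ξ

instance {n : ℕ} (ξ : ℝ) (y : Fin n → Y) : IsMarkovKernel (M.step q ξ y) := by
  unfold step; infer_instance

/-- The law of `k` successive iterations, as a kernel from the initial state. -/
def run {n : ℕ} (ξ : ℝ) (y : Fin n → Y) : (k : ℕ) → Kernel Θ (Fin k → Iteration Θ d)
  | 0 => Kernel.const Θ (Measure.dirac Fin.elim0)
  | k + 1 =>
    (M.step q ξ y ⊗ₖ (run ξ y k).comap (fun p : Θ × Iteration Θ d => p.2.2)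
      (measurable_snd.comp measurable_snd)).map
        (fun p => Fin.cons (α := fun _ => Iteration Θ d) p.1 p.2)

lemma measurable_cons {k : ℕ} {X : Type*} [MeasurableSpace X] :
    Measurable fun p : X × (Fin k → X) => Fin.cons (α := fun _ => X) p.1 p.2 := by
  refine measurable_pi_iff.2 fun i => ?_
  refine Fin.cases ?_ (fun j => ?_) i
  · simpa using measurable_fst
  · simp only [Fin.cons_succ]
    exact (measurable_pi_apply j).comp measurable_snd

instance {n : ℕ} (ξ : ℝ) (y : Fin n → Y) (k : ℕ) : IsMarkovKernel (M.run q ξ y k) := by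
  induction k with
  | zero => unfold run; infer_instance
  | succ k ih => unfold run; exact Kernel.IsMarkovKernel.map _ measurable_cons

/-- The law of the view of the adversary
`{θ_t, θ'_t, ŝ^{(t)} ; 1 ≤ t ≤ k}` for the data set `y`, started at `θ₀`. -/
def viewLaw {n : ℕ} (ξ : ℝ) (k : ℕ) (θ₀ : Θ) (y : Fin n → Y) :
    Measure (Fin k → Iteration Θ d) :=
  M.run q ξ y k θ₀

/-- The joint law `P` of the proposed and generated samples `(θ'_t, θ_t)`, `1 ≤ t ≤ k`. -/
def chainLaw {n : ℕ} (ξ : ℝ) (k : ℕ) (θ₀ : Θ) (y : Fin n → Y) : Measure (Fin k → Θ × Θ) :=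
  (M.viewLaw q ξ k θ₀ y).map fun w t => ((w t).1.1, (w t).2)

/-- The noise level `ξ_n = σ² (∇₂ S)² n^{2α} / c²`. -/
def noiseVar (c α σ : ℝ) (n : ℕ) : ℝ :=
  σ ^ 2 * M.sensitivity ^ 2 * (n : ℝ) ^ (2 * α) / c ^ 2

end ExpModel

/-- The state `θ_{t-1}` from which the proposal of an iteration is made: `θ₀` for the first
iteration, and the second component of the preceding entry afterwards. -/
def prevState {k : ℕ} (θ₀ : Θ) (w : Fin k → Θ × Θ) (t : Fin k) : Θ :=
  if t.val = 0 then θ₀ else (w ⟨t.val - 1, (Nat.sub_le _ _).trans_lt t.isLt⟩).2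

/-- For all `n ≥ 1`, `‖φ(θ'_t) - φ(θ_{t-1})‖ < c n^{-α}` almost surely at every iteration of the
chain started at `θ₀`, for each noise parameter `σ` and each data set. -/
def BoundedProposals (M : ExpModel Θ Y lam ν d) (q : ℕ → Proposal Θ lam) (c α : ℝ) (θ₀ : Θ) :
    Prop :=
  ∀ n : ℕ, 1 ≤ n → ∀ σ : ℝ, 0 < σ → ∀ (y : Fin n → Y) (k : ℕ),
    ∀ᵐ w ∂(M.chainLaw (q n) (M.noiseVar c α σ n) k θ₀ y),
      ∀ t, ‖M.φ (w t).1 - M.φ (prevState θ₀ w t)‖ < c * (n : ℝ) ^ (-α)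

end Kernels

/-- The number of iterations `⌊k₀ n^{2α} / log n⌋`. -/
def iterations (k₀ α : ℝ) (n : ℕ) : ℕ := ⌊k₀ * (n : ℝ) ^ (2 * α) / Real.log n⌋₊

/-- `2 √(k₀ (2α + β) β) c / σ + 4 k₀ (c² / σ²) (2α + β)`. -/
def epsBound (k₀ α β c σ : ℝ) : ℝ :=
  2 * Real.sqrt (k₀ * (2 * α + β) * β) * (c / σ) + 4 * k₀ * (c ^ 2 / σ ^ 2) * (2 * α + β)

/-- `1.25 k₀ n^{-β} / log n + n^{-β}`. -/
def deltaBound (k₀ β : ℝ) (n : ℕ) : ℝ :=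
  1.25 * k₀ * (n : ℝ) ^ (-β) / Real.log n + (n : ℝ) ^ (-β)

end PenaltyDP

end

/-! Proposals and accept-reject decisions are kernels that see the data only through the noisy
statistics already in the view. Hence the laws of the view for neighbouring `x`, `y` have a density
ratio equal to the product of `k` Gaussian ratios (`run_eq_withDensity`), and its moment of order
`l` under the law for `x` is explicit: `exp (k l (l + 1) Δ² / (2 ξ))` with `Δ = ‖S_n(x) - S_n(y)‖`
(`lintegral_run_prod`, `lintegral_gaussianRatio_rpow`). Markov's inequality turns this moment into
an `(ε, δ)` bound for any `l ≥ 0` (`run_apply_le`). Write `s = 2α + β`, `L = log n`, `K = k₀ c² /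
σ²`. The choice of `ξ_n` and `k(n)` gives `k Δ² / ξ ≤ K / L`; the order `l = s L` then yields `δ ≤
n^{-β}`, provided `s L ≥ 1/5` and `β ≤ K s²`. If `s L ≤ 1/5`, either no iteration is run or the
claimed `δ` is at least `1`. The penalty variance is bounded because the factors `n^{2α}` and `c²`
in `ξ_n` cancel against the squared step bound. -/

namespace PenaltyDP

/-! ### Gaussian shifts, density ratios and their moments -/

section Gaussian

variable {ι : Type*} [Fintype ι]

/-- The moment generating function of a standard Gaussian vector at a complex argument. -/
lemma integral_cexp_stdGaussian (z : ι → ℂ) :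
    ∫ x, Complex.exp (∑ i, z i * (x i : ℂ)) ∂stdGaussian (EuclideanSpace ℝ ι) =
      Complex.exp (∑ i, z i ^ 2 / 2) := by
  rw [← map_pi_eq_stdGaussian, integral_map (by fun_prop)
    (Measurable.aestronglyMeasurable (by fun_prop))]
  simp_rw [Complex.exp_sum]
  rw [integral_fintype_prod_eq_prod (f := fun i (x : ℝ) => Complex.exp (z i * (x : ℂ)))]
  refine Finset.prod_congr rfl fun i _ => ?_
  have h := complexMGF_id_gaussianReal (μ := 0) (v := 1) (z i)
  simpa [complexMGF] using h

/-- The Cameron-Martin formula for the standard Gaussian measure. -/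
lemma withDensity_stdGaussian (u : EuclideanSpace ℝ ι) :
    (stdGaussian (EuclideanSpace ℝ ι)).withDensity
        (fun x => ENNReal.ofReal (Real.exp (inner ℝ u x - ‖u‖ ^ 2 / 2))) =
      (stdGaussian (EuclideanSpace ℝ ι)).map (fun x => x + u) := by
  set γ := stdGaussian (EuclideanSpace ℝ ι)
  have hu : ∑ i, (u i : ℂ) ^ 2 = ((‖u‖ ^ 2 : ℝ) : ℂ) := by
    rw [EuclideanSpace.real_norm_sq_eq]; push_cast; rfl
  have hint : Integrable (fun x => Real.exp (inner ℝ u x - ‖u‖ ^ 2 / 2)) γ := by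
    have h := integral_cexp_stdGaussian (fun i => (u i : ℂ))
    have h1 : Integrable
        (fun x : EuclideanSpace ℝ ι => Complex.exp (∑ i, (u i : ℂ) * (x i : ℂ))) γ := by
      -- Without integrability the Bochner integral would be `0` by convention, but its value is an
      -- exponential.
      by_contra hc
      rw [integral_undef hc] at h
      exact Complex.exp_ne_zero _ h.symm
    have h2 := h1.norm.mul_const (Real.exp (-(‖u‖ ^ 2 / 2)))
    refine h2.congr (Filter.Eventually.of_forall fun x => ?_)
    simp only [Complex.norm_exp]
    rw [← Real.exp_add]
    congr 1
    simp only [Complex.re_sum, ← Complex.ofReal_mul, Complex.ofReal_re, PiLp.inner_apply]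
    simp [sub_eq_add_neg, mul_comm]
  have : IsFiniteMeasure (γ.withDensity
      fun x => ENNReal.ofReal (Real.exp (inner ℝ u x - ‖u‖ ^ 2 / 2))) :=
    isFiniteMeasure_withDensity_ofReal hint.2
  -- Both characteristic functions reduce to the complex moment generating function, at `u + i t` on
  -- the left and at `i t` on the right.
  refine Measure.ext_of_charFun ?_
  ext t
  rw [charFun_apply, charFun_apply, integral_map (by fun_prop) (by fun_prop),
    integral_withDensity_eq_integral_toReal_smul (by fun_prop) (by simp)]
  have hL : ∀ x : EuclideanSpace ℝ ι,
      (ENNReal.ofReal (Real.exp (inner ℝ u x - ‖u‖ ^ 2 / 2))).toReal •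
        Complex.exp ((inner ℝ x t : ℝ) * Complex.I) =
      Complex.exp (-((‖u‖ ^ 2 : ℝ) : ℂ) / 2) *
        Complex.exp (∑ i, ((u i : ℂ) + t i * Complex.I) * (x i : ℂ)) := by
    intro x
    rw [ENNReal.toReal_ofReal (Real.exp_pos _).le, Complex.real_smul, Complex.ofReal_exp,
      ← Complex.exp_add, ← Complex.exp_add]
    congr 1
    simp only [PiLp.inner_apply, RCLike.inner_apply, conj_trivial, add_mul, Finset.sum_add_distrib]
    push_cast
    rw [Finset.sum_mul]
    have e1 : ∑ i, (x i : ℂ) * (u i : ℂ) = ∑ i, (u i : ℂ) * (x i : ℂ) :=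
      Finset.sum_congr rfl fun _ _ => mul_comm _ _
    have e2 : ∑ i, (t i : ℂ) * (x i : ℂ) * Complex.I = ∑ i, (t i : ℂ) * Complex.I * (x i : ℂ) :=
      Finset.sum_congr rfl fun _ _ => by ring
    rw [e1, e2]; ring
  have hR : ∀ x : EuclideanSpace ℝ ι,
      Complex.exp ((inner ℝ (x + u) t : ℝ) * Complex.I) =
      Complex.exp (∑ i, (t i : ℂ) * (u i : ℂ) * Complex.I) *
        Complex.exp (∑ i, ((t i : ℂ) * Complex.I) * (x i : ℂ)) := by
    intro x
    rw [← Complex.exp_add]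
    congr 1
    simp only [PiLp.inner_apply, RCLike.inner_apply, conj_trivial]
    push_cast
    rw [Finset.sum_mul, ← Finset.sum_add_distrib]
    refine Finset.sum_congr rfl fun i _ => ?_
    simp; ring
  simp_rw [hL, hR]
  rw [integral_const_mul, integral_const_mul, integral_cexp_stdGaussian,
    integral_cexp_stdGaussian, ← Complex.exp_add, ← Complex.exp_add, ← hu]
  congr 1
  rw [neg_div, Finset.sum_div, ← Finset.sum_neg_distrib, ← Finset.sum_add_distrib,
    ← Finset.sum_add_distrib]
  exact Finset.sum_congr rfl fun i _ => by ring

lemma lintegral_exp_stdGaussian (v : EuclideanSpace ℝ ι) (b : ℝ) :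
    ∫⁻ x, ENNReal.ofReal (Real.exp (inner ℝ v x + b)) ∂stdGaussian (EuclideanSpace ℝ ι) =
      ENNReal.ofReal (Real.exp (‖v‖ ^ 2 / 2 + b)) := by
  have h : ∫⁻ x, ENNReal.ofReal (Real.exp (inner ℝ v x - ‖v‖ ^ 2 / 2))
      ∂stdGaussian (EuclideanSpace ℝ ι) = 1 := by
    rw [← setLIntegral_univ, ← withDensity_apply _ MeasurableSet.univ, withDensity_stdGaussian,
      Measure.map_apply (by fun_prop) MeasurableSet.univ]
    simp
  have h1 : ∀ x, ENNReal.ofReal (Real.exp (inner ℝ v x + b)) =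
      ENNReal.ofReal (Real.exp (‖v‖ ^ 2 / 2 + b)) *
        ENNReal.ofReal (Real.exp (inner ℝ v x - ‖v‖ ^ 2 / 2)) := fun x => by
    rw [← ENNReal.ofReal_mul (Real.exp_pos _).le, ← Real.exp_add]
    congr 2; ring
  simp_rw [h1]
  rw [lintegral_const_mul _ (by fun_prop), h, mul_one]

/-- The density of `N(a, ξ I)` with respect to `N(b, ξ I)`. -/
noncomputable def gaussianRatio (a b : EuclideanSpace ℝ ι) (ξ : ℝ) (s : EuclideanSpace ℝ ι) : ℝ≥0∞ :=
  ENNReal.ofReal (Real.exp (inner ℝ (a - b) (s - b) / ξ - ‖a - b‖ ^ 2 / (2 * ξ)))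

@[fun_prop]
lemma measurable_gaussianRatio (a b : EuclideanSpace ℝ ι) (ξ : ℝ) :
    Measurable (gaussianRatio a b ξ) := by
  unfold gaussianRatio; fun_prop

variable [DecidableEq ι]

open scoped MatrixOrder in
lemma multivariateGaussian_smul_one (a : EuclideanSpace ℝ ι) {ξ : ℝ} (hξ : 0 ≤ ξ) :
    multivariateGaussian a (ξ • (1 : Matrix ι ι ℝ)) =
      (stdGaussian (EuclideanSpace ℝ ι)).map fun x => a + Real.sqrt ξ • x := by
  have h : CFC.sqrt (ξ • (1 : Matrix ι ι ℝ)) = Real.sqrt ξ • (1 : Matrix ι ι ℝ) := by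
    refine CFC.sqrt_unique ?_ ?_
    · rw [smul_mul_smul_comm, Real.mul_self_sqrt hξ, mul_one]
    · exact smul_nonneg (Real.sqrt_nonneg ξ) zero_le_one
  rw [multivariateGaussian, h]
  simp

/-- In standardised coordinates a change of mean from `b` to `a` is a shift by `(a - b) / √ξ`, to
which Cameron-Martin applies. -/
lemma lintegral_multivariateGaussian_eq (a b : EuclideanSpace ℝ ι) {ξ : ℝ} (hξ : 0 < ξ)
    {f : EuclideanSpace ℝ ι → ℝ≥0∞} (hf : Measurable f) :
    ∫⁻ s, f s ∂multivariateGaussian a (ξ • (1 : Matrix ι ι ℝ)) =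
      ∫⁻ s, f s * gaussianRatio a b ξ s ∂multivariateGaussian b (ξ • (1 : Matrix ι ι ℝ)) := by
  have hs := Real.sqrt_pos.2 hξ
  have hsq := Real.sq_sqrt hξ.le
  rw [multivariateGaussian_smul_one a hξ.le, multivariateGaussian_smul_one b hξ.le,
    lintegral_map hf (by fun_prop), lintegral_map (by fun_prop) (by fun_prop)]
  set r := Real.sqrt ξ
  have hab : ∀ x : EuclideanSpace ℝ ι, a + r • x = b + r • (x + r⁻¹ • (a - b)) := fun x => by
    rw [smul_add, smul_smul, mul_inv_cancel₀ hs.ne', one_smul]; abel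
  simp_rw [hab]
  have h1 := lintegral_map (μ := stdGaussian (EuclideanSpace ℝ ι))
    (f := fun x => f (b + r • x)) (g := fun x => x + r⁻¹ • (a - b)) (by fun_prop) (by fun_prop)
  rw [← h1, ← withDensity_stdGaussian,
    lintegral_withDensity_eq_lintegral_mul _ (by fun_prop) (by fun_prop)]
  refine lintegral_congr fun x => ?_
  simp only [Pi.mul_apply]
  rw [mul_comm, gaussianRatio]
  congr 3
  rw [add_sub_cancel_left, real_inner_smul_left, real_inner_smul_right, norm_smul, ← hsq,
    norm_inv, Real.norm_of_nonneg hs.le]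
  field_simp

/-- The log-ratio is affine in the standard Gaussian, so its `l`-th power is again an exponential
integral. With `ρ = ‖a - b‖² / ξ`, the Gaussian part contributes `l² ρ / 2` and the mean under `a`
contributes `l ρ / 2`. -/
lemma lintegral_gaussianRatio_rpow (a b : EuclideanSpace ℝ ι) {ξ : ℝ} (hξ : 0 < ξ) (l : ℝ) :
    ∫⁻ s, gaussianRatio a b ξ s ^ l ∂multivariateGaussian a (ξ • (1 : Matrix ι ι ℝ)) =
      ENNReal.ofReal (Real.exp (l * (l + 1) * (‖a - b‖ ^ 2 / ξ) / 2)) := by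
  have hs := Real.sqrt_pos.2 hξ
  have hsq := Real.sq_sqrt hξ.le
  rw [multivariateGaussian_smul_one a hξ.le, lintegral_map (by fun_prop) (by fun_prop)]
  set r := Real.sqrt ξ
  have h1 : ∀ x : EuclideanSpace ℝ ι, gaussianRatio a b ξ (a + r • x) ^ l =
      ENNReal.ofReal (Real.exp (inner ℝ ((l * r⁻¹) • (a - b)) x +
        l * (‖a - b‖ ^ 2 / ξ) / 2)) := fun x => by
    rw [gaussianRatio, ENNReal.ofReal_rpow_of_pos (Real.exp_pos _), ← Real.exp_mul,
      show a + r • x - b = (a - b) + r • x by abel, inner_add_right, real_inner_smul_left,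
      real_inner_smul_right, real_inner_self_eq_norm_sq, ← hsq]
    congr 2
    field_simp
    ring
  simp_rw [h1]
  rw [lintegral_exp_stdGaussian, norm_smul, norm_mul, norm_inv, Real.norm_of_nonneg hs.le, ← hsq]
  congr 2
  rw [mul_pow, mul_pow, Real.norm_eq_abs, sq_abs]
  field_simp

end Gaussian

/-- A measure whose density with respect to another one has a finite moment satisfies an
approximate domination, by Markov's inequality. -/
lemma withDensity_le_exp_mul_add {Ω : Type*} [MeasurableSpace Ω] {P Q : Measure Ω}
    {D : Ω → ℝ≥0∞} (hD : Measurable D) (hP : P = Q.withDensity D) (ε : ℝ) {l : ℝ} (hl : 0 ≤ l)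
    {K : ℝ} (hK : ∫⁻ w, D w ^ l ∂P ≤ ENNReal.ofReal (Real.exp K)) {s : Set Ω}
    (hs : MeasurableSet s) :
    P s ≤ ENNReal.ofReal (Real.exp ε) * Q s + ENNReal.ofReal (Real.exp (K - l * ε)) := by
  set e := ENNReal.ofReal (Real.exp ε)
  -- Where the density is at most `exp ε` the domination is pointwise; the rest has small `P`-mass
  -- by Markov applied to `D ^ l`.
  have hT : MeasurableSet {w | D w ≤ e} := measurableSet_le hD measurable_const
  have h1 : P (s ∩ {w | D w ≤ e}) ≤ e * Q s := by
    rw [hP, withDensity_apply _ (hs.inter hT)]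
    calc ∫⁻ w in s ∩ {w | D w ≤ e}, D w ∂Q ≤ ∫⁻ _ in s ∩ {w | D w ≤ e}, e ∂Q :=
          setLIntegral_mono measurable_const fun w hw => hw.2
      _ = e * Q (s ∩ {w | D w ≤ e}) := setLIntegral_const _ _
      _ ≤ e * Q s := by gcongr; exact Set.inter_subset_left
  have h2 : P {w | D w ≤ e}ᶜ ≤ ENNReal.ofReal (Real.exp (K - l * ε)) := by
    have hm := mul_meas_ge_le_lintegral (μ := P) (hD.pow_const l) (ENNReal.ofReal (Real.exp (l * ε)))
    have hsub : {w | D w ≤ e}ᶜ ⊆ {w | ENNReal.ofReal (Real.exp (l * ε)) ≤ D w ^ l} := by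
      intro w hw
      have hw' : e ≤ D w := (not_le.1 (show ¬ D w ≤ e from hw)).le
      have := ENNReal.rpow_le_rpow hw' hl
      rwa [ENNReal.ofReal_rpow_of_pos (Real.exp_pos _), ← Real.exp_mul, mul_comm ε l] at this
    have h3 := (mul_le_mul_right (measure_mono hsub) (ENNReal.ofReal (Real.exp (l * ε)))).trans
      (hm.trans hK)
    calc P {w | D w ≤ e}ᶜ
        = ENNReal.ofReal (Real.exp (-(l * ε))) *
            (ENNReal.ofReal (Real.exp (l * ε)) * P {w | D w ≤ e}ᶜ) := by
          rw [← mul_assoc, ← ENNReal.ofReal_mul (Real.exp_pos _).le, ← Real.exp_add]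
          simp
      _ ≤ ENNReal.ofReal (Real.exp (-(l * ε))) * ENNReal.ofReal (Real.exp K) := by gcongr
      _ = _ := by
          rw [← ENNReal.ofReal_mul (Real.exp_pos _).le, ← Real.exp_add]
          congr 2; ring
  calc P s ≤ P (s ∩ {w | D w ≤ e}) + P (s \ {w | D w ≤ e}) := measure_le_inter_add_sdiff _ _ _
    _ ≤ _ := add_le_add h1 ((measure_mono fun w hw => hw.2).trans h2)

/-! ### Density ratio of the views and the effect of changing one entry -/

namespace ExpModel

variable {Θ : Type*} [MeasurableSpace Θ] {lam : Measure Θ} [SigmaFinite lam]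
  {Y : Type*} [MeasurableSpace Y] {ν : Measure Y} {d : ℕ}
  (M : ExpModel Θ Y lam ν d) (q : Proposal Θ lam)

lemma lintegral_step {n : ℕ} (ξ : ℝ) (y : Fin n → Y) (θ : Θ) {f : Iteration Θ d → ℝ≥0∞}
    (hf : Measurable f) :
    ∫⁻ a, f a ∂M.step q ξ y θ =
      ∫⁻ θ', ∫⁻ s, ∫⁻ θ'', f ((θ', s), θ'') ∂M.decision q n ξ (θ, (θ', s))
        ∂multivariateGaussian (M.stat y) (ξ • 1) ∂q.kernel θ := by
  rw [step, Kernel.lintegral_compProd _ _ _ hf, Kernel.lintegral_prod]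
  · simp
  · exact hf.lintegral_kernel_prod_right'
      (κ := (M.decision q n ξ).comap (fun p => (θ, p)) measurable_prodMk_left)

lemma lintegral_run_succ {n : ℕ} (ξ : ℝ) (y : Fin n → Y) (k : ℕ) (θ : Θ)
    {f : (Fin (k + 1) → Iteration Θ d) → ℝ≥0∞} (hf : Measurable f) :
    ∫⁻ w, f w ∂M.run q ξ y (k + 1) θ =
      ∫⁻ a, ∫⁻ w, f (Fin.cons a w) ∂M.run q ξ y k a.2 ∂M.step q ξ y θ := by
  rw [run, Kernel.lintegral_map _ measurable_cons _ hf,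
    Kernel.lintegral_compProd _ _ _
      (f := fun p => f (Fin.cons (α := fun _ => Iteration Θ d) p.1 p.2)) (hf.comp measurable_cons)]
  rfl

/-- Only the noisy statistics depend on the data, so that the laws of the views of two data sets
have the product of the density ratios of the noisy statistics as their density ratio. -/
lemma run_eq_withDensity {n : ℕ} {ξ : ℝ} (hξ : 0 < ξ) (x y : Fin n → Y) (k : ℕ) (θ : Θ) :
    M.run q ξ x k θ = (M.run q ξ y k θ).withDensity
      fun w => ∏ t, gaussianRatio (M.stat x) (M.stat y) ξ (w t).1.2 := by
  set D := gaussianRatio (M.stat x) (M.stat y) ξ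
  have hD : Measurable D := measurable_gaussianRatio _ _ _
  suffices h : ∀ f : (Fin k → Iteration Θ d) → ℝ≥0∞, Measurable f →
      ∫⁻ w, f w ∂M.run q ξ x k θ = ∫⁻ w, f w * ∏ t, D (w t).1.2 ∂M.run q ξ y k θ by
    refine Measure.ext_of_lintegral _ fun f hf => ?_
    rw [h f hf, lintegral_withDensity_eq_lintegral_mul _ (by fun_prop) hf]
    simp [mul_comm]
  -- The initial state must vary, since the remaining iterations start at the random state `a.2`.
  induction k generalizing θ with
  | zero => intro f hf; simp [run]
  | succ k ih =>
    intro f hf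
    have hfc : ∀ a, Measurable fun w : Fin k → Iteration Θ d =>
        f (Fin.cons (α := fun _ => Iteration Θ d) a w) := fun a =>
      hf.comp (measurable_cons.comp measurable_prodMk_left)
    rw [lintegral_run_succ _ _ _ _ _ _ hf, lintegral_run_succ _ _ _ _ _ _ (by fun_prop)]
    simp_rw [Fin.prod_univ_succ, Fin.cons_zero, Fin.cons_succ]
    have h1 : ∀ a : Iteration Θ d, ∫⁻ w, f (Fin.cons a w) ∂M.run q ξ x k a.2 =
        ∫⁻ w, f (Fin.cons a w) * ∏ t, D (w t).1.2 ∂M.run q ξ y k a.2 := fun a => ih _ _ (hfc a)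
    have h2 : ∀ a : Iteration Θ d,
        ∫⁻ w, f (Fin.cons a w) * (D a.1.2 * ∏ t, D (w t).1.2) ∂M.run q ξ y k a.2 =
        (∫⁻ w, f (Fin.cons a w) * ∏ t, D (w t).1.2 ∂M.run q ξ y k a.2) * D a.1.2 := fun a => by
      rw [← lintegral_mul_const (D a.1.2)
        (f := fun w => f (Fin.cons a w) * ∏ t, D (w t).1.2) ((hfc a).mul (by fun_prop))]
      refine lintegral_congr fun w => ?_
      ring
    simp_rw [h1, h2]
    have hg : Measurable fun a : Iteration Θ d =>
        ∫⁻ w, f (Fin.cons a w) * ∏ t, D (w t).1.2 ∂M.run q ξ y k a.2 := by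
      have : Measurable fun p : Iteration Θ d × (Fin k → Iteration Θ d) =>
          f (Fin.cons (α := fun _ => Iteration Θ d) p.1 p.2) * ∏ t, D (p.2 t).1.2 :=
        (hf.comp measurable_cons).mul (by fun_prop)
      exact this.lintegral_kernel_prod_right'
        (κ := (M.run q ξ y k).comap (fun a : Iteration Θ d => a.2) measurable_snd)
    -- The integral over the remaining iterations now involves only `y`; from here on it matters
    -- only as a measurable function of the first iteration.
    generalize hgg : (fun a : Iteration Θ d =>
      ∫⁻ w, f (Fin.cons a w) * ∏ t, D (w t).1.2 ∂M.run q ξ y k a.2) = g at hg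
    have hgg' (a : Iteration Θ d) :
        ∫⁻ w, f (Fin.cons a w) * ∏ t, D (w t).1.2 ∂M.run q ξ y k a.2 = g a := by rw [← hgg]
    simp_rw [hgg']
    rw [lintegral_step _ _ _ _ _ hg, lintegral_step _ _ _ _ _ (by fun_prop)]
    refine lintegral_congr fun θ' => ?_
    have hdec : ∀ g : Iteration Θ d → ℝ≥0∞, Measurable g →
        Measurable fun s => ∫⁻ θ'', g ((θ', s), θ'') ∂M.decision q n ξ (θ, (θ', s)) := by
      intro g hg
      have : Measurable fun p : EuclideanSpace ℝ (Fin d) × Θ => g ((θ', p.1), p.2) := by fun_prop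
      exact this.lintegral_kernel_prod_right'
        (κ := (M.decision q n ξ).comap (fun s => (θ, (θ', s))) (by fun_prop))
    -- The noisy statistic is the only place where the two one-step laws differ: proposal and
    -- decision kernels are shared.
    rw [lintegral_multivariateGaussian_eq (M.stat x) (M.stat y) hξ (hdec _ hg)]
    refine lintegral_congr fun s => ?_
    rw [← lintegral_mul_const _ (by fun_prop)]

/-- The noisy statistics of the successive iterations are independent. -/
lemma lintegral_run_prod {n : ℕ} (ξ : ℝ) (y : Fin n → Y) (k : ℕ) (θ : Θ)
    {G : EuclideanSpace ℝ (Fin d) → ℝ≥0∞} (hG : Measurable G) :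
    ∫⁻ w, ∏ t, G (w t).1.2 ∂M.run q ξ y k θ =
      (∫⁻ s, G s ∂multivariateGaussian (M.stat y) (ξ • 1)) ^ k := by
  induction k generalizing θ with
  | zero => simp
  | succ k ih =>
    rw [lintegral_run_succ _ _ _ _ _ _ (by fun_prop)]
    simp_rw [Fin.prod_univ_succ, Fin.cons_zero, Fin.cons_succ]
    have h (a : Iteration Θ d) : ∫⁻ w, G a.1.2 * ∏ t, G (w t).1.2 ∂M.run q ξ y k a.2 =
        G a.1.2 * (∫⁻ s, G s ∂multivariateGaussian (M.stat y) (ξ • 1)) ^ k := by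
      rw [lintegral_const_mul _ (by fun_prop), ih]
    simp_rw [h]
    rw [lintegral_mul_const _ (by fun_prop), lintegral_step _ _ _ _ _ (by fun_prop), pow_succ']
    simp

/-- The privacy guarantee of `k` iterations, for two data sets whose statistics differ. -/
lemma run_apply_le {n : ℕ} {ξ : ℝ} (hξ : 0 < ξ) (x y : Fin n → Y) (k : ℕ) (θ : Θ) (ε : ℝ)
    {l : ℝ} (hl : 0 ≤ l) {s : Set (Fin k → Iteration Θ d)} (hs : MeasurableSet s) :
    M.run q ξ x k θ s ≤ ENNReal.ofReal (Real.exp ε) * M.run q ξ y k θ s +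
      ENNReal.ofReal (Real.exp
        (k * (l * (l + 1) * (‖M.stat x - M.stat y‖ ^ 2 / ξ) / 2) - l * ε)) := by
  refine withDensity_le_exp_mul_add (by fun_prop) (M.run_eq_withDensity q hξ x y k θ) ε hl ?_ hs
  simp_rw [← ENNReal.prod_rpow_of_nonneg hl]
  rw [lintegral_run_prod _ _ _ _ _ _ ((measurable_gaussianRatio _ _ _).pow_const l),
    lintegral_gaussianRatio_rpow _ _ hξ, ← ENNReal.ofReal_pow (Real.exp_pos _).le, ← Real.exp_nat_mul]

lemma step_congr {n : ℕ} (ξ : ℝ) {x y : Fin n → Y} (h : M.stat x = M.stat y) :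
    M.step q ξ x = M.step q ξ y := by
  unfold step; rw [h]

lemma run_congr {n : ℕ} (ξ : ℝ) {x y : Fin n → Y} (h : M.stat x = M.stat y) (k : ℕ) :
    M.run q ξ x k = M.run q ξ y k := by
  induction k with
  | zero => rfl
  | succ k ih => simp only [run, M.step_congr q ξ h, ih]

lemma norm_stat_sub_le (hS : BddAbove (Set.range fun p : Y × Y => ‖M.S p.1 - M.S p.2‖)) {n : ℕ}
    (x y : Fin n → Y) (h : (letI := Classical.decEq Y; hammingDist x y) ≤ 1) :
    ‖M.stat x - M.stat y‖ ≤ M.sensitivity := by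
  classical
  have hle : ∀ a b, ‖M.S a - M.S b‖ ≤ M.sensitivity := fun a b => le_ciSup hS (a, b)
  have h0 : 0 ≤ M.sensitivity := Real.iSup_nonneg fun _ => norm_nonneg _
  rw [stat, stat, ← Finset.sum_sub_distrib]
  have hcard : (Finset.univ.filter fun i => x i ≠ y i).card ≤ 1 := by
    convert h
    rw [hammingDist]
  have hsum : ∑ i, (M.S (x i) - M.S (y i)) =
      ∑ i ∈ Finset.univ.filter fun i => x i ≠ y i, (M.S (x i) - M.S (y i)) := by
    rw [Finset.sum_filter_of_ne]
    intro i _ hi hxy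
    exact hi (by rw [hxy, sub_self])
  rw [hsum]
  refine (norm_sum_le_of_le _ fun i _ => hle (x i) (y i)).trans ?_
  rw [Finset.sum_const, nsmul_eq_mul]
  calc _ ≤ (1 : ℝ) * M.sensitivity := by gcongr; exact_mod_cast hcard
    _ = _ := one_mul _

end ExpModel

/-! ### Penalty variance and the scalar inequalities -/

namespace ExpModel

variable {Θ : Type*} [MeasurableSpace Θ] {lam : Measure Θ} [SigmaFinite lam]
  {Y : Type*} [MeasurableSpace Y] {ν : Measure Y} {d : ℕ}
  (M : ExpModel Θ Y lam ν d) (q : Proposal Θ lam)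

lemma penaltyVar_noiseVar_le {c α σ : ℝ} (hc : 0 < c) {n : ℕ} (hn : 1 ≤ n) {θ θ' : Θ}
    (h : ‖M.φ θ' - M.φ θ‖ < c * (n : ℝ) ^ (-α)) :
    M.penaltyVar (M.noiseVar c α σ n) θ θ' ≤ M.sensitivity ^ 2 * σ ^ 2 := by
  have hn0 : (0 : ℝ) < n := by exact_mod_cast hn
  have hp : (n : ℝ) ^ (2 * α) = ((n : ℝ) ^ α) ^ 2 := by
    rw [mul_comm, Real.rpow_mul hn0.le]; norm_cast
  have hpos : 0 < (n : ℝ) ^ α := Real.rpow_pos_of_pos hn0 _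
  have h2 : ‖M.φ θ' - M.φ θ‖ ^ 2 ≤ (c * (n : ℝ) ^ (-α)) ^ 2 := by gcongr
  rw [penaltyVar, noiseVar, real_inner_self_eq_norm_sq, hp]
  calc _ ≤ (c * (n : ℝ) ^ (-α)) ^ 2 *
        (σ ^ 2 * M.sensitivity ^ 2 * ((n : ℝ) ^ α) ^ 2 / c ^ 2) := by gcongr
    _ = _ := by rw [Real.rpow_neg hn0.le]; field_simp

end ExpModel

/-- When `(2α + β) log n` is small, the number of iterations can only be positive if the bound on
`δ` is trivial. -/
lemma one_le_deltaBound {α β k₀ : ℝ} {n : ℕ} (hn : 2 ≤ n)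
    (hk : iterations k₀ α n ≠ 0) (hs : (2 * α + β) * Real.log n ≤ 1 / 5) :
    1 ≤ deltaBound k₀ β n := by
  have hn0 : (0 : ℝ) < n := by positivity
  have hL : 0 < Real.log n := Real.log_pos (by exact_mod_cast hn)
  have h1 : (1 : ℝ) ≤ k₀ * (n : ℝ) ^ (2 * α) / Real.log n :=
    Nat.floor_pos.1 (Nat.pos_of_ne_zero hk)
  have hp : 0 < (n : ℝ) ^ (2 * α) := Real.rpow_pos_of_pos hn0 _
  have hb : 0 < (n : ℝ) ^ (-β) := Real.rpow_pos_of_pos hn0 _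
  have h2 : (n : ℝ) ^ (-(2 * α + β)) ≤ k₀ * (n : ℝ) ^ (-β) / Real.log n := by
    have e : (n : ℝ) ^ (-β) = (n : ℝ) ^ (-(2 * α + β)) * (n : ℝ) ^ (2 * α) := by
      rw [← Real.rpow_add hn0]; congr 1; ring
    calc (n : ℝ) ^ (-(2 * α + β)) = (n : ℝ) ^ (-(2 * α + β)) * 1 := (mul_one _).symm
      _ ≤ (n : ℝ) ^ (-(2 * α + β)) * (k₀ * (n : ℝ) ^ (2 * α) / Real.log n) := by gcongr
      _ = _ := by rw [e]; ring
  have h3 : 4 / 5 ≤ (n : ℝ) ^ (-(2 * α + β)) := by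
    rw [Real.rpow_def_of_pos hn0]
    have := Real.add_one_le_exp (Real.log n * -(2 * α + β))
    linarith
  rw [deltaBound]
  -- The factor `5/4` in `δ` exactly offsets the lower bound `4/5`; this is what fixes the threshold
  -- `1/5`.
  have e : 1.25 * k₀ * (n : ℝ) ^ (-β) / Real.log n =
      5 / 4 * (k₀ * (n : ℝ) ^ (-β) / Real.log n) := by ring
  rw [e]; linarith

/-- Since `1 ≤ 5 s L`, the moment term is at most `K s (s L + 1) / 2 ≤ 3 K s² L`. The term `s L ε ≥
4 K s² L` beats it by `K s² L ≥ β L`. -/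
lemma exponent_le {s L K β m ε : ℝ} (hs : 0 < s) (hL : 0 < L) (hK : 0 < K) (hm : m ≤ K / L)
    (hsL : 1 / 5 ≤ s * L) (hβ : β ≤ K * s ^ 2) (hε : 4 * K * s ≤ ε) :
    s * L * (s * L + 1) * m / 2 - s * L * ε ≤ -(β * L) := by
  have hsl : 0 < s * L := by positivity
  have h1 : s * L * (s * L + 1) * m / 2 ≤ s * L * (s * L + 1) * (K / L) / 2 := by gcongr
  have h2 : s * L * (4 * K * s) ≤ s * L * ε := by gcongr
  have h3 : s * L * (s * L + 1) * (K / L) / 2 = K * s * (s * L + 1) / 2 := by field_simp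
  have h4 : β * L ≤ K * s ^ 2 * L := by gcongr
  have h5 : 0 ≤ K * s * (s * L - 1 / 5) :=
    mul_nonneg (by positivity) (by linarith)
  nlinarith

/-! ### Privacy of the view and choice of the noise -/

namespace ExpModel

variable {Θ : Type*} [MeasurableSpace Θ] {lam : Measure Θ} [SigmaFinite lam]
  {Y : Type*} [MeasurableSpace Y] {ν : Measure Y} {d : ℕ}
  (M : ExpModel Θ Y lam ν d) (q : Proposal Θ lam)

theorem isDP_viewLaw (hS : BddAbove (Set.range fun p : Y × Y => ‖M.S p.1 - M.S p.2‖))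
    {c α σ β k₀ : ℝ} (hc : 0 < c) (hα : 0 < α) (hσ : 0 < σ) (hβ : 0 < β) (hk₀ : 0 < k₀)
    (hσβ : β ≤ k₀ * (c ^ 2 / σ ^ 2) * (2 * α + β) ^ 2) (θ₀ : Θ) {n : ℕ} (hn : 2 ≤ n) :
    IsDP (M.viewLaw (n := n) q (M.noiseVar c α σ n) (iterations k₀ α n) θ₀)
      (epsBound k₀ α β c σ) (deltaBound k₀ β n) := by
  obtain ⟨k, hk⟩ : ∃ k, k = iterations k₀ α n := ⟨_, rfl⟩
  rw [← hk]
  intro x y hxy A hA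
  have hs : 0 < 2 * α + β := by positivity
  have hn0 : (0 : ℝ) < n := by positivity
  have hL : 0 < Real.log n := Real.log_pos (by exact_mod_cast hn)
  have hK : 0 < k₀ * (c ^ 2 / σ ^ 2) := by positivity
  -- The second summand of `ε` alone carries the argument; the square-root term is only used to be
  -- nonnegative.
  have hε : 4 * (k₀ * (c ^ 2 / σ ^ 2)) * (2 * α + β) ≤ epsBound k₀ α β c σ := by
    have : 0 ≤ 2 * Real.sqrt (k₀ * (2 * α + β) * β) * (c / σ) := by positivity
    rw [epsBound]; linarith
  have hε0 : 0 ≤ epsBound k₀ α β c σ := le_trans (by positivity) hε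
  simp only [viewLaw]
  set ξ := M.noiseVar c α σ n with hξ
  have heq : M.run q ξ x k θ₀ = M.run q ξ y k θ₀ → M.run q ξ x k θ₀ A ≤
      ENNReal.ofReal (Real.exp (epsBound k₀ α β c σ)) * M.run q ξ y k θ₀ A +
        ENNReal.ofReal (deltaBound k₀ β n) := fun h => by
    rw [h]
    refine le_add_right (le_mul_of_one_le_left' ?_)
    rw [ENNReal.one_le_ofReal]
    exact Real.one_le_exp hε0
  -- Equal statistics give equal laws. Splitting this case off forces positive sensitivity, hence `ξ
  -- > 0`, so that the Gaussians have densities.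
  by_cases hst : M.stat x = M.stat y
  · exact heq (by rw [M.run_congr q ξ hst])
  by_cases hk0 : k = 0
  · refine heq ?_
    rw [hk0]; rfl
  rcases le_total ((2 * α + β) * Real.log n) (1 / 5) with hsmall | hlarge
  · calc M.run q ξ x k θ₀ A ≤ 1 := prob_le_one
      _ ≤ ENNReal.ofReal (deltaBound k₀ β n) :=
        ENNReal.one_le_ofReal.2 (one_le_deltaBound hn (hk ▸ hk0) hsmall)
      _ ≤ _ := le_add_self
  have hsens := M.norm_stat_sub_le hS x y hxy
  have hpos : 0 < ‖M.stat x - M.stat y‖ := norm_pos_iff.2 (sub_ne_zero.2 hst)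
  have hsens0 : 0 < M.sensitivity := hpos.trans_le hsens
  have hp : 0 < (n : ℝ) ^ (2 * α) := Real.rpow_pos_of_pos hn0 _
  have hξ0 : 0 < ξ := by rw [hξ, noiseVar]; positivity
  have hkle : (k : ℝ) ≤ k₀ * (n : ℝ) ^ (2 * α) / Real.log n := by
    rw [hk]
    exact Nat.floor_le (by positivity)
  have hm : k * (‖M.stat x - M.stat y‖ ^ 2 / ξ) ≤ k₀ * (c ^ 2 / σ ^ 2) / Real.log n := by
    calc k * (‖M.stat x - M.stat y‖ ^ 2 / ξ)
        ≤ (k₀ * (n : ℝ) ^ (2 * α) / Real.log n) * (M.sensitivity ^ 2 / ξ) := by gcongr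
      _ = _ := by rw [hξ, noiseVar]; field_simp
  -- The moment order is `l = (2α + β) log n`: as `ε` does not depend on `n`, it must grow like `log
  -- n` for `exp (-l ε)` to decay as a power of `n`.
  refine (M.run_apply_le q hξ0 x y k θ₀ (epsBound k₀ α β c σ)
    (mul_pos hs hL).le hA).trans ?_
  gcongr
  refine (Real.exp_le_exp.2 (?_ : _ ≤ -(β * Real.log n))).trans ?_
  · have := exponent_le hs hL hK hm hlarge hσβ hε
    refine le_trans (le_of_eq ?_) this
    ring
  · rw [deltaBound, Real.rpow_def_of_pos hn0, show Real.log n * -β = -(β * Real.log n) by ring]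
    exact le_add_of_nonneg_left (by positivity)

end ExpModel

end PenaltyDP

theorem mainTheorem2 {Θ Y : Type*} [MeasurableSpace Θ] [MeasurableSpace Y]
    {lam : Measure Θ} [SigmaFinite lam] {ν : Measure Y} {d : ℕ}
    (M : PenaltyDP.ExpModel Θ Y lam ν d) (q : ℕ → PenaltyDP.Proposal Θ lam)
    (hS : BddAbove (Set.range fun p : Y × Y => ‖M.S p.1 - M.S p.2‖))
    (c α : ℝ) (hc : 0 < c) (hα : 0 < α)
    (β k₀ : ℝ) (hβ : 0 < β) (hk₀ : 0 < k₀) (θ₀ : Θ)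
    (hprop : PenaltyDP.BoundedProposals M q c α θ₀) :
    ∃ σ : ℝ, 0 < σ ∧
      (∀ n : ℕ, 2 ≤ n →
        PenaltyDP.IsDP
          (M.viewLaw (n := n) (q n) (M.noiseVar c α σ n) (PenaltyDP.iterations k₀ α n) θ₀)
          (PenaltyDP.epsBound k₀ α β c σ) (PenaltyDP.deltaBound k₀ β n)) ∧
      (∀ n : ℕ, 1 ≤ n → ∀ θ θ' : Θ, ‖M.φ θ' - M.φ θ‖ < c * (n : ℝ) ^ (-α) →
        M.penaltyVar (M.noiseVar c α σ n) θ θ' ≤ M.sensitivity ^ 2 * σ ^ 2) ∧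
      (∀ n : ℕ, 1 ≤ n → ∀ (y : Fin n → Y) (k : ℕ),
        ∀ᵐ w ∂(M.chainLaw (q n) (M.noiseVar c α σ n) k θ₀ y),
          ∀ t, M.penaltyVar (M.noiseVar c α σ n) (PenaltyDP.prevState θ₀ w t) (w t).1 ≤
            M.sensitivity ^ 2 * σ ^ 2) := by
  have hs : 0 < 2 * α + β := by positivity
  have hroot : 0 < Real.sqrt (k₀ / β) := Real.sqrt_pos.2 (by positivity)
  have hσ : 0 < c * (2 * α + β) * Real.sqrt (k₀ / β) := by positivity
  -- This is the largest `σ` with `β ≤ k₀ (c² / σ²) (2α + β)²`, the condition under which the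
  -- exponent reaches `-β log n`; equality holds.
  refine ⟨c * (2 * α + β) * Real.sqrt (k₀ / β), hσ, fun n hn => ?_, fun n hn θ θ' h => ?_,
    fun n hn y k => ?_⟩
  · refine M.isDP_viewLaw (q n) hS hc hα hσ hβ hk₀ (le_of_eq ?_) θ₀ hn
    rw [mul_pow, Real.sq_sqrt (by positivity)]
    field_simp
  · exact M.penaltyVar_noiseVar_le hc hn h
  · filter_upwards [hprop n hn _ hσ y k] with w hw t
    exact M.penaltyVar_noiseVar_le hc hn (hw t)
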